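/- A *tensor network embedding* consists of a finite simple graph on a vertex set $V_E$, $|V_E|=N_E$, with an array (tensor) $\mathcal A_v$ at each vertex $v$; the edges of the graph are dimensions contracted between the two adjacent tensors, and in addition finitely many uncontracted dimensions are each attached to one vertex, some as input dimensions (set $\bar E$, $N=|\bar E|$) and some as output dimensions. Summing the product of all tensors over all contracted indices and grouping the output dimensions into the row and the input dimensions into the column gives a matrix $S$. The embedding is *Gaussian* if, for some ordering (linearization) of the vertices, the entries of all tensors are independent and those of $\mathcal A_v$ are $N(0,1/r_v)$-distributed, where $r_v$ is the product of the sizes of the output dimensions at $v$ and of the contracted dimensions that $v$ shares with later vertices (so every $\mathcal A_v$, unfolded with these dimensions as rows, is a normalized Gaussian matrix). A random matrix $S$ is *$(\epsilon,\delta)$-accurate* if $\Pr\big(\big|\|Sx\|_2^2-1\big|>\epsilon\big)<\delta$ for every fixed vector $x$ with $\|x\|_2=1$. **Corollary.** For every $\delta_0<1$ there is a constant $C>0$, depending only on $\delta_0$, such that the following holds for all $0<\epsilon\le 1$ and $0<\delta\le\delta_0$. Consider a Gaussian tensor network embedding that has exactly one output dimension, of size $m$, all of whose contracted dimensions have size $m$,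 and whose input dimensions have arbitrary sizes. 1. If the graph of the embedding is a tree and $m\ge C\,N_E\log(1/\delta)/\epsilon^2$, then the embedding is $(\epsilon,\delta)$-accurate. 2. If the embedding is a tensor train (MPS), that is, its graph is a path, each vertex carries exactly one input dimension, and the output dimension is attached to an endpoint of the path, and if $m\ge C\,N\log(1/\delta)/\epsilon^2$, where $N$ is the number of input dimensions, then the embedding is $(\epsilon,\delta)$-accurate. In particular, a sketch size $m=\Theta(N_E\log(1/\delta)/\epsilon^2)$, respectively $m=\Theta(N\log(1/\delta)/\epsilon^2)$, with a sufficiently large constant suffices. -/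

import Mathlib

open MeasureTheory ProbabilityTheory

/-- The structure of a tensor network embedding: a graph whose vertices `V` carry the tensors and
whose edges are the contracted dimensions, together with uncontracted edges, each attached to one
vertex: those indexed by `I` are the input dimensions (the ones that connect the embedding to the
data) and those indexed by `O` are the output (sketch) dimensions. Every edge carries the size of
the dimension which it stands for. -/
structure TensorNetworkEmbedding (V I O : Type*) where
  graph : SimpleGraph V
  bondDim : graph.edgeSet → ℕ
  inVertex : I → V
  inDim : I → ℕ
  outVertex : O → V
  outDim : O → ℕ

namespace TensorNetworkEmbedding

variable {V I O : Type*} (T : TensorNetworkEmbedding V I O)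

/-- All edges: contracted, input, and output ones. -/
abbrev Edge : Type _ := T.graph.edgeSet ⊕ (I ⊕ O)

/-- The dimension size represented by an edge. -/
def size : T.Edge → ℕ
  | Sum.inl e => T.bondDim e
  | Sum.inr (Sum.inl i) => T.inDim i
  | Sum.inr (Sum.inr o) => T.outDim o

/-- The edge `e` is adjacent to the vertex `v`. -/
def Incident : T.Edge → V → Prop
  | Sum.inl e, v => v ∈ (e : Sym2 V)
  | Sum.inr (Sum.inl i), v => T.inVertex i = v
  | Sum.inr (Sum.inr o), v => T.outVertex o = v

/-- Multi-indices of the tensor at `v`: one coordinate for each edge adjacent to `v`. -/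
abbrev TensorIndex (v : V) : Type _ := (e : {e : T.Edge // T.Incident e v}) → Fin (T.size e.1)

/-- Multi-indices of the contracted dimensions. -/
abbrev BondIndex : Type _ := (e : T.graph.edgeSet) → Fin (T.bondDim e)

/-- Multi-indices of the input dimensions: the columns of the embedding matrix. -/
abbrev InIndex : Type _ := (i : I) → Fin (T.inDim i)

/-- Multi-indices of the output dimensions: the rows of the embedding matrix. -/
abbrev OutIndex : Type _ := (o : O) → Fin (T.outDim o)

/-- The index on every edge, put together from output, input and contracted multi-indices. -/
def label (o : T.OutIndex) (i : T.InIndex) (b : T.BondIndex) : (e : T.Edge) → Fin (T.size e)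
  | Sum.inl e => b e
  | Sum.inr (Sum.inl k) => i k
  | Sum.inr (Sum.inr k) => o k

open Classical in
/-- The matrix represented by the network with tensor `A v` at each vertex `v`: the contraction of
all tensors along the contracted edges, with output dimensions grouped into the row and
input dimensions grouped into the column. -/
noncomputable def contract [Fintype V] (A : (v : V) → T.TensorIndex v → ℝ) :
    Matrix T.OutIndex T.InIndex ℝ :=
  Matrix.of fun o i => ∑ b : T.BondIndex, ∏ v : V, A v (fun e => T.label o i b e.1)

open Classical in
/-- For a linearization, i.e. an ordering `σ` of the vertices: the row size of the matricization of
the tensor at `v` in which the output dimensions at `v` and the contracted dimensions shared with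
later vertices are combined into the row, and all other dimensions into the column. -/
noncomputable def rowSize [Fintype V] [Fintype O] (σ : V ≃ Fin (Fintype.card V)) (v : V) : ℕ :=
  (∏ o : O with T.outVertex o = v, T.outDim o) *
    ∏ e ∈ Finset.univ.filter
      (fun e : T.graph.edgeSet => ∃ u, (e : Sym2 V) = s(v, u) ∧ σ v < σ u), T.bondDim e

/-- The random matrix `S` of the embedding whose tensor at `v` is `Z v / √(row size of v)`. When
the `Z v` are filled with independent standard normal variables, the matricization of every
tensor with respect to the linearization `σ` is thus a (normalized) Gaussian embedding. -/
noncomputable def embeddingMatrix [Fintype V] [Fintype O] (σ : V ≃ Fin (Fintype.card V))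
    {Ω : Type*} (Z : (v : V) → T.TensorIndex v → Ω → ℝ) (ω : Ω) :
    Matrix T.OutIndex T.InIndex ℝ :=
  T.contract fun v k => (1 / √(T.rowSize σ v : ℝ)) * Z v k ω

/-- The tensor train (MPS) structure: the tensors form a path, each tensor carries exactly one
input dimension, and output dimensions occur only at an endpoint of the path. -/
def IsTensorTrain [Fintype V] : Prop :=
  Function.Bijective T.inVertex ∧
    ∃ f : T.graph ≃g SimpleGraph.pathGraph (Fintype.card V),
      ∀ o, (f (T.outVertex o)).val = 0 ∨ (f (T.outVertex o)).val + 1 = Fintype.card V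

end TensorNetworkEmbedding

/-- All entries of all the arrays `Z v` are independent standard normal random variables. -/
def IsIIDStandardNormal {V : Type*} {K : V → Type*} {Ω : Type*} [MeasurableSpace Ω]
    (P : Measure Ω) (Z : (v : V) → K v → Ω → ℝ) : Prop :=
  (∀ v k, HasLaw (Z v k) (gaussianReal 0 1) P) ∧
    iIndepFun (fun p : (v : V) × K v => Z p.1 p.2) P

/-- A random matrix is an `(ε, δ)`-accurate embedding if for every fixed unit vector `x` the
probability of `|‖S x‖₂² - 1| > ε` is less than `δ`. -/
def IsAccurateEmbedding {J K Ω : Type*} [Fintype J] [Fintype K] [MeasurableSpace Ω]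
    (P : Measure Ω) (S : Ω → Matrix J K ℝ) (ε δ : ℝ) : Prop :=
  ∀ x : EuclideanSpace ℝ K, ‖x‖ = 1 →
    P.real {ω | ε < |‖WithLp.toLp 2 ((S ω).mulVec x)‖ ^ 2 - 1|} < δ

/-
Apply the tensors to the input one at a time, in the order of a linearization. Each of them acts as
a normalized Gaussian matrix with `rowSize v` rows on the columns of the intermediate array, and
for `s ∉ [0, 1)` convexity of `t ↦ t ^ s` bounds the `s`-th moment of the squared norm after the
step by the `s`-th moment of a normalized chi-square variable times the moment before the step. The
moments of `‖S x‖²` of orders `±p` are therefore at most products of chi-square moments, and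
Markov's inequality with `p` of order `log (1 / δ) / ε` gives the accuracy once every row size is
at least `m`. Finally, `S` depends on the linearization only through the product of all row sizes,
which is the product of all output and contracted dimensions, so one may order the vertices by
decreasing distance to an output vertex; then every row contains an output or a contracted
dimension.
-/

open scoped RealInnerProductSpace in
lemma map_inner_stdGaussian {E O : Type*} [NormedAddCommGroup E] [InnerProductSpace ℝ E]
    [FiniteDimensional ℝ E] [MeasurableSpace E] [BorelSpace E] [Fintype O] {w : O → E}
    (hw : Orthonormal ℝ w) :
    (stdGaussian E).map (fun g => WithLp.toLp 2 fun o => ⟪w o, g⟫) =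
      stdGaussian (EuclideanSpace ℝ O) := by
  have hmeas : Measurable fun g : E => (WithLp.toLp 2 fun o => ⟪w o, g⟫ : EuclideanSpace ℝ O) := by
    fun_prop
  have := Measure.isProbabilityMeasure_map (μ := stdGaussian E) hmeas.aemeasurable
  refine Measure.ext_of_charFun (E := EuclideanSpace ℝ O) (funext fun t => ?_)
  have hadjoint (g : E) :
      ⟪(WithLp.toLp 2 fun o => ⟪w o, g⟫ : EuclideanSpace ℝ O), t⟫ = ⟪g, ∑ o, t o • w o⟫ := by
    simp only [PiLp.inner_apply, inner_sum, inner_smul_right, real_inner_comm g]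
    simp
  have hnorm : ‖∑ o, t o • w o‖ ^ 2 = ‖t‖ ^ 2 := by
    rw [← real_inner_self_eq_norm_sq, hw.inner_sum, EuclideanSpace.real_norm_sq_eq]
    exact Finset.sum_congr rfl fun o _ => by simp [sq]
  have hchar : charFun ((stdGaussian E).map fun g => (WithLp.toLp 2 fun o => ⟪w o, g⟫ :
      EuclideanSpace ℝ O)) t = charFun (stdGaussian E) (∑ o, t o • w o) := by
    rw [charFun_apply, charFun_apply, integral_map hmeas.aemeasurable (by fun_prop)]
    simp only [hadjoint]
  rw [hchar, charFun_stdGaussian, charFun_stdGaussian]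
  norm_cast
  rw [hnorm]

lemma map_sum_mul_pi_gaussianReal {O C K : Type*} [Fintype O] [Fintype C] [Fintype K]
    {ι : O → C → K} (hι : Function.Injective2 ι) {u : C → ℝ} (hu : ∑ c, u c ^ 2 = 1) :
    (Measure.pi fun _ : K => gaussianReal 0 1).map (fun g o => ∑ c, g (ι o c) * u c) =
      Measure.pi fun _ : O => gaussianReal 0 1 := by
  classical
  let w : O → EuclideanSpace ℝ K := fun o => ∑ c, u c • EuclideanSpace.single (ι o c) (1 : ℝ)
  have hw : Orthonormal ℝ w := by
    rw [orthonormal_iff_ite]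
    intro o o'
    simp only [w, sum_inner, inner_sum, inner_smul_left, inner_smul_right,
      EuclideanSpace.inner_single_left, PiLp.single_apply, hι.eq_iff]
    by_cases h : o = o'
    · simpa [h, sq] using hu
    · simp [h]
  have hmap := congrArg (Measure.map (MeasurableEquiv.toLp 2 (O → ℝ)).symm)
    (map_inner_stdGaussian hw)
  rw [← map_pi_eq_stdGaussian, ← map_pi_eq_stdGaussian,
    Measure.map_map (by fun_prop) (by fun_prop), Measure.map_map (by fun_prop) (by fun_prop),
    Measure.map_map (by fun_prop) (by fun_prop)] at hmap
  convert hmap using 2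
  · ext g o
    simp [w, sum_inner, inner_smul_left, EuclideanSpace.inner_single_left, mul_comm]
  · exact Measure.map_id.symm

lemma convexOn_rpow_of_neg {s : ℝ} (hs : s < 0) :
    ConvexOn ℝ (Set.Ioi 0) fun x : ℝ => x ^ s := by
  have hlog : ConvexOn ℝ (Set.Ioi 0) fun x : ℝ => s * Real.log x := by
    refine (strictConcaveOn_log_Ioi.concaveOn.neg.smul (neg_nonneg.2 hs.le)).congr fun x _ => ?_
    simp
  have himage : Convex ℝ ((fun x : ℝ => s * Real.log x) '' Set.Ioi 0) := by
    refine (hlog.1.isPreconnected.image _ ?_).ordConnected.convex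
    exact (Real.continuousOn_log.mono fun x hx => ne_of_gt hx).const_mul s
  refine ((convexOn_exp.subset (Set.subset_univ _) himage).comp hlog
    (Real.exp_monotone.monotoneOn _)).congr fun x hx => ?_
  rw [Function.comp_apply, Real.rpow_def_of_pos hx, mul_comm]

lemma ofReal_sum_rpow_le_of_neg {R : Type*} [Fintype R] {s : ℝ} (hs : s < 0) {w z : R → ℝ}
    (hw : ∀ r, 0 < w r) (hw1 : ∑ r, w r = 1) (hz : ∀ r, 0 ≤ z r) :
    ENNReal.ofReal (∑ r, w r * z r) ^ s ≤
      ∑ r, ENNReal.ofReal (w r) * ENNReal.ofReal (z r) ^ s := by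
  by_cases hzero : ∃ r, z r = 0
  · obtain ⟨r, hr⟩ := hzero
    refine le_top.trans_eq (ENNReal.sum_eq_top.2 ⟨r, Finset.mem_univ r, ?_⟩).symm
    rw [hr, ENNReal.ofReal_zero, ENNReal.zero_rpow_of_neg hs, ENNReal.mul_top]
    simpa using hw r
  push Not at hzero
  have hz' (r : R) : 0 < z r := (hz r).lt_of_ne' (hzero r)
  have hpos : 0 < ∑ r, w r * z r := by
    refine Finset.sum_pos (fun r _ => mul_pos (hw r) (hz' r)) (Finset.nonempty_iff_ne_empty.2 ?_)
    rintro hempty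
    simp [hempty] at hw1
  rw [ENNReal.ofReal_rpow_of_pos hpos]
  calc ENNReal.ofReal ((∑ r, w r * z r) ^ s)
      ≤ ENNReal.ofReal (∑ r, w r * z r ^ s) := ENNReal.ofReal_le_ofReal <|
        (convexOn_rpow_of_neg hs).map_sum_le (fun r _ => (hw r).le) hw1 fun r _ => hz' r
    _ = ∑ r, ENNReal.ofReal (w r) * ENNReal.ofReal (z r) ^ s := by
      rw [ENNReal.ofReal_sum_of_nonneg fun r _ =>
        mul_nonneg (hw r).le (Real.rpow_nonneg (hz r) _)]
      simp only [ENNReal.ofReal_mul (hw _).le, ENNReal.ofReal_rpow_of_pos (hz' _)]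

lemma ofReal_sum_rpow_le {R : Type*} [Fintype R] {s : ℝ} (hs : 1 ≤ s ∨ s < 0) {w z : R → ℝ}
    (hw : ∀ r, 0 ≤ w r) (hw1 : ∑ r, w r = 1) (hz : ∀ r, 0 ≤ z r) :
    ENNReal.ofReal (∑ r, w r * z r) ^ s ≤
      ∑ r, ENNReal.ofReal (w r) * ENNReal.ofReal (z r) ^ s := by
  classical
  rcases hs with hs | hs
  · rw [ENNReal.ofReal_sum_of_nonneg fun r _ => mul_nonneg (hw r) (hz r)]
    simp only [ENNReal.ofReal_mul (hw _)]
    refine ENNReal.rpow_arith_mean_le_arith_mean_rpow _ _ _ ?_ hs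
    rw [← ENNReal.ofReal_sum_of_nonneg fun r _ => hw r, hw1, ENNReal.ofReal_one]
  · have hpos (r : {r // w r ≠ 0}) : 0 < w r := (hw r).lt_of_ne' r.2
    have hsupp {M : Type} [AddCommMonoid M] {f : R → M} (hf : ∀ r, w r = 0 → f r = 0) :
        ∑ r : {r // w r ≠ 0}, f r = ∑ r, f r :=
      (Finset.sum_subtype {r | w r ≠ 0} (by simp) f).symm.trans
        (Finset.sum_filter_of_ne fun r _ h => mt (hf r) h)
    rw [← hsupp fun r hr => by simp [hr], ← hsupp fun r hr => by simp [hr]]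
    rw [← hsupp fun r hr => hr] at hw1
    exact ofReal_sum_rpow_le_of_neg hs hpos hw1 fun r => hz r

lemma lintegral_ofReal_sum_rpow_le {α R : Type*} [MeasurableSpace α] {μ : Measure α} [Fintype R]
    {s : ℝ} (hs : 1 ≤ s ∨ s < 0) {w : R → ℝ} (hw : ∀ r, 0 ≤ w r) (hw1 : ∑ r, w r = 1)
    {Z : R → α → ℝ} (hZ : ∀ r, Measurable (Z r)) (hZ0 : ∀ r a, 0 ≤ Z r a) {M : ENNReal}
    (hM : ∀ r, ∫⁻ a, ENNReal.ofReal (Z r a) ^ s ∂μ ≤ M) :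
    ∫⁻ a, ENNReal.ofReal (∑ r, w r * Z r a) ^ s ∂μ ≤ M := by
  calc ∫⁻ a, ENNReal.ofReal (∑ r, w r * Z r a) ^ s ∂μ
      ≤ ∫⁻ a, ∑ r, ENNReal.ofReal (w r) * ENNReal.ofReal (Z r a) ^ s ∂μ :=
        lintegral_mono fun a => ofReal_sum_rpow_le hs hw hw1 fun r => hZ0 r a
    _ = ∑ r, ENNReal.ofReal (w r) * ∫⁻ a, ENNReal.ofReal (Z r a) ^ s ∂μ := by
      rw [lintegral_finsetSum _ (by fun_prop)]
      exact Finset.sum_congr rfl fun r _ => lintegral_const_mul _ (by fun_prop)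
    _ ≤ ∑ r, ENNReal.ofReal (w r) * M := by gcongr with r; exact hM r
    _ = M := by
      rw [← Finset.sum_mul, ← ENNReal.ofReal_sum_of_nonneg fun r _ => hw r, hw1,
        ENNReal.ofReal_one, one_mul]

/-- The moment of order `s` of the normalized chi-square distribution with `n` degrees of freedom,
that is, of the mean of the squares of `n` independent standard Gaussians. -/
noncomputable def chiSquareMoment (n : ℕ) (s : ℝ) : ENNReal :=
  ∫⁻ g : Fin n → ℝ, ENNReal.ofReal ((∑ i, g i ^ 2) / n) ^ s ∂Measure.pi fun _ => gaussianReal 0 1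

lemma chiSquareMoment_card (O : Type*) [Fintype O] (s : ℝ) :
    chiSquareMoment (Fintype.card O) s =
      ∫⁻ g : O → ℝ, ENNReal.ofReal ((∑ o, g o ^ 2) / Fintype.card O) ^ s
        ∂Measure.pi fun _ => gaussianReal 0 1 := by
  have hequiv := measurePreserving_piCongrLeft (fun _ : O => gaussianReal 0 1)
    (Fintype.equivFin O).symm
  rw [chiSquareMoment, ← hequiv.lintegral_comp (by fun_prop)]
  refine lintegral_congr fun g => ?_
  rw [← Fintype.sum_equiv (Fintype.equivFin O).symm (fun i => g i ^ 2)]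
  intro i
  simp [MeasurableEquiv.coe_piCongrLeft]

lemma chiSquareMoment_ne_zero_of_neg (n : ℕ) {s : ℝ} (hs : s < 0) : chiSquareMoment n s ≠ 0 := by
  intro h
  rw [chiSquareMoment, lintegral_eq_zero_iff (by fun_prop)] at h
  obtain ⟨g, hg⟩ := h.exists
  simp only [Pi.zero_apply, ENNReal.rpow_eq_zero_iff, ENNReal.ofReal_ne_top, false_and,
    or_false] at hg
  exact hg.2.not_gt hs

section Contraction

variable {O C K : Type*} [Fintype O] [Fintype C] [Fintype K] {ι : O → C → K}

lemma lintegral_contract_rpow_of_unit (hι : Function.Injective2 ι) {u : C → ℝ}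
    (hu : ∑ c, u c ^ 2 = 1) (s : ℝ) :
    ∫⁻ g : K → ℝ, ENNReal.ofReal ((∑ o, (∑ c, g (ι o c) * u c) ^ 2) / Fintype.card O) ^ s
        ∂Measure.pi (fun _ => gaussianReal 0 1) = chiSquareMoment (Fintype.card O) s := by
  rw [chiSquareMoment_card, ← map_sum_mul_pi_gaussianReal hι hu,
    lintegral_map (by fun_prop) (by fun_prop)]

lemma exists_eq_sqrt_mul_unit [Nonempty C] (x : C → ℝ) :
    ∃ u : C → ℝ, ∑ c, u c ^ 2 = 1 ∧ ∀ c, x c = √(∑ c, x c ^ 2) * u c := by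
  classical
  by_cases hx : ∑ c, x c ^ 2 = 0
  · refine ⟨Pi.single (Classical.arbitrary C) 1, by simp [Pi.single_apply], fun c => ?_⟩
    rw [Finset.sum_eq_zero_iff_of_nonneg fun c _ => sq_nonneg (x c)] at hx
    simp [fun c => pow_eq_zero_iff two_ne_zero |>.1 (hx c (Finset.mem_univ c))]
  · have hpos : 0 < ∑ c, x c ^ 2 := (Finset.sum_nonneg fun c _ => sq_nonneg _).lt_of_ne' hx
    refine ⟨fun c => x c / √(∑ c, x c ^ 2), ?_, fun c => (mul_div_cancel₀ _ (by positivity)).symm⟩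
    simp only [div_pow, Real.sq_sqrt hpos.le, ← Finset.sum_div, div_self hx]

lemma lintegral_contract_rpow_le {R : Type*} [Fintype R] (hι : Function.Injective2 ι)
    (X : R → C → ℝ) {s : ℝ} (hs : 1 ≤ s ∨ s < 0) :
    ∫⁻ g : K → ℝ, ENNReal.ofReal ((∑ r, ∑ o, (∑ c, g (ι o c) * X r c) ^ 2) / Fintype.card O) ^ s
        ∂Measure.pi (fun _ => gaussianReal 0 1) ≤
      chiSquareMoment (Fintype.card O) s * ENNReal.ofReal (∑ r, ∑ c, X r c ^ 2) ^ s := by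
  have hq (r : R) : 0 ≤ ∑ c, X r c ^ 2 := Finset.sum_nonneg fun c _ => sq_nonneg _
  rcases (Finset.sum_nonneg fun r (_ : r ∈ Finset.univ) => hq r).eq_or_lt with hX | hX
  · have hzero : ∀ r c, X r c = 0 := by
      simpa [Finset.sum_eq_zero_iff_of_nonneg, Finset.sum_nonneg, sq_nonneg] using hX.symm
    rcases hs with hs | hs
    · simp [hzero, show 0 < s by linarith]
    · rw [← hX, ENNReal.ofReal_zero, ENNReal.zero_rpow_of_neg hs,
        ENNReal.mul_top (chiSquareMoment_ne_zero_of_neg _ hs)]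
      exact le_top
  have : Nonempty C := by
    by_contra hC
    rw [not_nonempty_iff] at hC
    simp at hX
  choose u hu hXu using fun r => exists_eq_sqrt_mul_unit (X r)
  let Z (r : R) (g : K → ℝ) : ℝ := (∑ o, (∑ c, g (ι o c) * u r c) ^ 2) / Fintype.card O
  have hmix (g : K → ℝ) : (∑ r, ∑ o, (∑ c, g (ι o c) * X r c) ^ 2) / Fintype.card O =
      (∑ r, ∑ c, X r c ^ 2) * ∑ r, (∑ c, X r c ^ 2) / (∑ r, ∑ c, X r c ^ 2) * Z r g := by
    rw [Finset.mul_sum, Finset.sum_div]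
    refine Finset.sum_congr rfl fun r _ => ?_
    have hrow (o : O) : ∑ c, g (ι o c) * X r c =
        √(∑ c, X r c ^ 2) * ∑ c, g (ι o c) * u r c := by
      rw [Finset.mul_sum]
      exact Finset.sum_congr rfl fun c _ => by rw [hXu r c]; ring
    simp only [hrow, mul_pow, Real.sq_sqrt (hq r), ← Finset.mul_sum, Z]
    field_simp
  simp only [hmix, ENNReal.ofReal_mul hX.le,
    ENNReal.mul_rpow_of_ne_top ENNReal.ofReal_ne_top ENNReal.ofReal_ne_top]
  rw [lintegral_const_mul _ (by fun_prop), mul_comm]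
  gcongr
  refine lintegral_ofReal_sum_rpow_le hs (fun r => div_nonneg (hq r) hX.le) ?_
    (fun r => by fun_prop) (fun r g => by positivity)
    fun r => (lintegral_contract_rpow_of_unit hι (hu r) s).le
  rw [← Finset.sum_div, div_self hX.ne']

end Contraction

lemma pi_gaussianReal_eq_withDensity (O : Type*) [Fintype O] :
    (Measure.pi fun _ : O => gaussianReal 0 1) =
      volume.withDensity fun g => ENNReal.ofReal (∏ o, gaussianPDFReal 0 1 (g o)) := by
  refine Measure.pi_eq fun s hs => ?_
  have h0 : ∀ g : O → ℝ, 0 ≤ ∏ o, gaussianPDFReal 0 1 (g o) := fun g =>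
    Finset.prod_nonneg fun o _ => gaussianPDFReal_nonneg _ _ _
  rw [withDensity_apply _ (MeasurableSet.univ_pi hs), volume_pi, Measure.restrict_pi_pi,
    ← ofReal_integral_eq_lintegral_ofReal]
  · rw [integral_fintype_prod_eq_prod (fun _ x => gaussianPDFReal 0 1 x),
      ENNReal.ofReal_prod_of_nonneg]
    · exact Finset.prod_congr rfl fun o _ => (gaussianReal_apply_eq_integral _ one_ne_zero _).symm
    · exact fun o _ => integral_nonneg fun x => gaussianPDFReal_nonneg _ _ _
  · exact Integrable.fintype_prod_dep fun o => (integrable_gaussianPDFReal 0 1).restrict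
  · exact Filter.Eventually.of_forall h0

lemma prod_gaussianPDFReal (O : Type*) [Fintype O] (g : O → ℝ) :
    ∏ o, gaussianPDFReal 0 1 (g o) =
      (√(2 * Real.pi))⁻¹ ^ Fintype.card O * Real.exp (-(1 / 2) * (∑ o, g o ^ 2)) := by
  simp only [gaussianPDFReal, Finset.prod_mul_distrib, ← Real.exp_sum]
  congr 1
  · simp
  · congr 1
    rw [Finset.mul_sum]
    exact Finset.sum_congr rfl fun o _ => by simp; ring

lemma lintegral_gaussian_radial (O : Type*) [Fintype O] {h : ℝ → ENNReal} (hh : Measurable h) :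
    ∫⁻ g : O → ℝ, h (∑ o, g o ^ 2) ∂Measure.pi (fun _ => gaussianReal 0 1) =
      ∫⁻ x : EuclideanSpace ℝ O, ENNReal.ofReal ((√(2 * Real.pi))⁻¹ ^ Fintype.card O *
        Real.exp (-(1 / 2) * ‖x‖ ^ 2)) * h (‖x‖ ^ 2) := by
  rw [pi_gaussianReal_eq_withDensity, lintegral_withDensity_eq_lintegral_mul _ (by
    simp only [prod_gaussianPDFReal]; fun_prop) (by fun_prop),
    ← (PiLp.volume_preserving_toLp O).lintegral_comp (by fun_prop)]
  refine lintegral_congr fun g => ?_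
  simp only [Pi.mul_apply, prod_gaussianPDFReal, EuclideanSpace.real_norm_sq_eq]

lemma lintegral_norm_rpow_mul_exp_neg_mul_sq {E : Type*} [NormedAddCommGroup E] [NormedSpace ℝ E]
    [FiniteDimensional ℝ E] [Nontrivial E] [MeasurableSpace E] [BorelSpace E] (μ : Measure E)
    [μ.IsAddHaarMeasure] {q b : ℝ} (hq : 0 < Module.finrank ℝ E + q) (hb : 0 < b) :
    ∫⁻ x, ENNReal.ofReal (‖x‖ ^ q * Real.exp (-b * ‖x‖ ^ 2)) ∂μ =
      ENNReal.ofReal (Module.finrank ℝ E * μ.real (Metric.ball 0 1) / 2 *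
        (b ^ (-(Module.finrank ℝ E + q) / 2) * Real.Gamma ((Module.finrank ℝ E + q) / 2))) := by
  set d := Module.finrank ℝ E with hd
  let f (y : ℝ) : ℝ := y ^ q * Real.exp (-b * y ^ 2)
  have hq' : -1 < (d : ℝ) - 1 + q := by linarith
  have hradial : Set.EqOn (fun y : ℝ => y ^ (d - 1) • f y)
      (fun y => y ^ ((d : ℝ) - 1 + q) * Real.exp (-b * y ^ (2 : ℝ))) (Set.Ioi 0) := by
    intro y hy
    have hd1 : (d : ℝ) - 1 = ((d - 1 : ℕ) : ℝ) := by
      rw [Nat.cast_sub (Module.finrank_pos (R := ℝ) (M := E)), Nat.cast_one]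
    simp only [f, smul_eq_mul, Real.rpow_add hy, hd1, Real.rpow_natCast, Real.rpow_two, mul_assoc]
  have hintegrable : Integrable (fun x => f ‖x‖) μ := by
    rw [integrable_fun_norm_addHaar, ← hd, integrableOn_congr_fun hradial measurableSet_Ioi]
    exact integrableOn_rpow_mul_exp_neg_mul_rpow hq' two_pos hb
  have hf (x : E) : 0 ≤ f ‖x‖ := by positivity
  rw [← ofReal_integral_eq_lintegral_ofReal hintegrable (Filter.Eventually.of_forall hf),
    integral_fun_norm_addHaar μ f, ← hd, setIntegral_congr_fun measurableSet_Ioi hradial,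
    integral_rpow_mul_exp_neg_mul_rpow two_pos hq' hb, nsmul_eq_mul, smul_eq_mul]
  congr 1
  ring_nf

lemma chiSquareMoment_zero (n : ℕ) : chiSquareMoment n 0 = 1 := by
  simp [chiSquareMoment]

lemma exists_chiSquareMoment_eq {n : ℕ} (hn : n ≠ 0) :
    ∃ c : ℝ, ∀ s : ℝ, 0 < n / 2 + s →
      chiSquareMoment n s = ENNReal.ofReal (c * ((2 / n) ^ s * Real.Gamma (n / 2 + s))) := by
  have : Nonempty (Fin n) := ⟨0, Nat.pos_of_ne_zero hn⟩
  set k : ℝ := (√(2 * Real.pi))⁻¹ ^ n with hk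
  refine ⟨k * (n * (volume : Measure (EuclideanSpace ℝ (Fin n))).real (Metric.ball 0 1) / 2 *
    (1 / 2) ^ (-(n : ℝ) / 2)), fun s hs => ?_⟩
  have hpolar : chiSquareMoment n s = ∫⁻ x : EuclideanSpace ℝ (Fin n), ENNReal.ofReal
      (k * (n : ℝ)⁻¹ ^ s) * ENNReal.ofReal (‖x‖ ^ (2 * s) * Real.exp (-(1 / 2) * ‖x‖ ^ 2)) := by
    rw [chiSquareMoment,
      lintegral_gaussian_radial (Fin n) (h := fun t => ENNReal.ofReal (t / n) ^ s) (by fun_prop)]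
    refine lintegral_congr_ae ?_
    filter_upwards [Measure.ae_ne volume (0 : EuclideanSpace ℝ (Fin n))] with x hx
    have hx' : 0 < ‖x‖ := norm_pos_iff.2 hx
    rw [ENNReal.ofReal_rpow_of_pos (by positivity), ← ENNReal.ofReal_mul (by positivity),
      ← ENNReal.ofReal_mul (by positivity), div_eq_mul_inv (‖x‖ ^ 2),
      Real.mul_rpow (by positivity) (by positivity), Real.rpow_mul hx'.le, Real.rpow_two,
      Fintype.card_fin, hk]
    ring_nf
  have hdim : (Module.finrank ℝ (EuclideanSpace ℝ (Fin n)) : ℝ) = n := by simp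
  rw [hpolar, lintegral_const_mul _ (by fun_prop), lintegral_norm_rpow_mul_exp_neg_mul_sq volume
    (by rw [hdim]; linarith) (by norm_num), hdim, ← ENNReal.ofReal_mul (by positivity)]
  have hexp : -((n : ℝ) + 2 * s) / 2 = -(n : ℝ) / 2 + -s := by ring
  have htwo : (1 / 2 : ℝ) ^ (-s) = 2 ^ s := by
    rw [Real.rpow_neg (by norm_num), one_div, Real.inv_rpow (by norm_num), inv_inv]
  rw [hexp, Real.rpow_add (by norm_num), htwo, div_eq_mul_inv 2 (n : ℝ),
    Real.mul_rpow (by norm_num) (by positivity)]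
  ring_nf

lemma chiSquareMoment_eq {n : ℕ} (hn : n ≠ 0) {s : ℝ} (hs : 0 < n / 2 + s) :
    chiSquareMoment n s =
      ENNReal.ofReal ((2 / n) ^ s * Real.Gamma (n / 2 + s) / Real.Gamma (n / 2)) := by
  obtain ⟨c, hc⟩ := exists_chiSquareMoment_eq hn
  have hΓ : 0 < Real.Gamma (n / 2) := Real.Gamma_pos_of_pos (by positivity)
  -- The total mass, `s = 0`, determines the constant.
  have hnorm := hc 0 (by positivity)
  rw [chiSquareMoment_zero, eq_comm, ENNReal.ofReal_eq_one] at hnorm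
  rw [hc s hs]
  congr 1
  rw [eq_div_iff hΓ.ne']
  simp only [Real.rpow_zero, one_mul, add_zero] at hnorm
  linear_combination (2 / (n : ℝ)) ^ s * Real.Gamma (n / 2 + s) * hnorm

lemma chiSquareMoment_add_one {n : ℕ} (hn : n ≠ 0) {s : ℝ} (hs : 0 < n / 2 + s) :
    chiSquareMoment n (s + 1) = ENNReal.ofReal (1 + 2 * s / n) * chiSquareMoment n s := by
  have hfactor : 1 + 2 * s / n = 2 / n * (n / 2 + s) := by field_simp
  rw [chiSquareMoment_eq hn hs, chiSquareMoment_eq hn (by linarith),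
    ← ENNReal.ofReal_mul (by rw [hfactor]; positivity), hfactor, ← add_assoc,
    Real.Gamma_add_one hs.ne', Real.rpow_add (by positivity), Real.rpow_one]
  ring_nf

lemma chiSquareMoment_natCast_le {n : ℕ} (hn : n ≠ 0) (p : ℕ) :
    chiSquareMoment n p ≤ ENNReal.ofReal (Real.exp (p ^ 2 / n)) := by
  induction p with
  | zero => simp [chiSquareMoment_zero]
  | succ p ih =>
    rw [Nat.cast_succ, chiSquareMoment_add_one hn (by positivity)]
    calc ENNReal.ofReal (1 + 2 * p / n) * chiSquareMoment n p
        ≤ ENNReal.ofReal (Real.exp (2 * p / n)) * ENNReal.ofReal (Real.exp (p ^ 2 / n)) := by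
          gcongr
          linarith [Real.add_one_le_exp (2 * (p : ℝ) / n)]
      _ = ENNReal.ofReal (Real.exp ((2 * p + p ^ 2) / n)) := by
          rw [← ENNReal.ofReal_mul (by positivity), ← Real.exp_add, add_div]
      _ ≤ ENNReal.ofReal (Real.exp ((p + 1) ^ 2 / n)) := by
          gcongr
          linarith

lemma chiSquareMoment_neg_natCast_le {n p : ℕ} (hp : 4 * p ≤ n) :
    chiSquareMoment n (-p) ≤ ENNReal.ofReal (Real.exp (4 * p ^ 2 / n)) := by
  induction p with
  | zero => simp [chiSquareMoment_zero]
  | succ p ih =>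
    have hn : (0 : ℝ) < n := by exact_mod_cast (by omega : 0 < n)
    have hp' : 4 * ((p : ℝ) + 1) ≤ n := by exact_mod_cast hp
    set t : ℝ := 2 * (p + 1) / n with ht
    have ht0 : 0 < t := by positivity
    have ht1 : t ≤ 1 / 2 := by rw [ht, div_le_iff₀ hn]; linarith
    have hrec : chiSquareMoment n (-p) =
        ENNReal.ofReal (1 - t) * chiSquareMoment n (-(p + 1 : ℕ)) := by
      have h := chiSquareMoment_add_one (n := n) (by omega) (s := -(p + 1 : ℕ))
        (by push_cast; linarith)
      rw [ht]
      convert h using 3 <;> push_cast <;> ring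
    have hinv : ENNReal.ofReal (1 - t) * ENNReal.ofReal (Real.exp (2 * t)) ≥ 1 := by
      rw [← ENNReal.ofReal_mul (by linarith)]
      refine ENNReal.one_le_ofReal.2 ?_
      nlinarith [Real.add_one_le_exp (2 * t)]
    calc chiSquareMoment n (-(p + 1 : ℕ))
        ≤ ENNReal.ofReal (1 - t) * ENNReal.ofReal (Real.exp (2 * t)) *
            chiSquareMoment n (-(p + 1 : ℕ)) := le_mul_of_one_le_left' hinv
      _ = ENNReal.ofReal (Real.exp (2 * t)) * chiSquareMoment n (-p) := by rw [hrec]; ring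
      _ ≤ ENNReal.ofReal (Real.exp (2 * t)) * ENNReal.ofReal (Real.exp (4 * p ^ 2 / n)) := by
        gcongr
        exact ih (by omega)
      _ = ENNReal.ofReal (Real.exp (4 * (p ^ 2 + p + 1) / n)) := by
        rw [← ENNReal.ofReal_mul (by positivity), ← Real.exp_add, ht]
        congr 2
        ring
      _ ≤ ENNReal.ofReal (Real.exp (4 * (p + 1 : ℕ) ^ 2 / n)) := by
        gcongr
        push_cast
        nlinarith

lemma chiSquareMoment_le_of_abs_eq {n p : ℕ} (hp0 : p ≠ 0) (hp : 4 * p ≤ n) {s : ℝ} (hs : |s| = p) :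
    chiSquareMoment n s ≤ ENNReal.ofReal (Real.exp (4 * p ^ 2 / n)) := by
  rcases eq_or_eq_neg_of_abs_eq hs with rfl | rfl
  · refine (chiSquareMoment_natCast_le (by omega) p).trans ?_
    gcongr
    linarith [sq_nonneg (p : ℝ)]
  · exact chiSquareMoment_neg_natCast_le hp

lemma prod_chiSquareMoment_le {V : Type*} [Fintype V] {r : V → ℕ} {m p : ℕ} (hr : ∀ v, m ≤ r v)
    (hp0 : p ≠ 0) {ε : ℝ} (hε : 0 < ε) (hε1 : ε ≤ 1) (hp : 16 * Fintype.card V * p ≤ m * ε)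
    {s : ℝ} (hs : |s| = p) :
    ∏ v, chiSquareMoment (r v) s ≤ ENNReal.ofReal (Real.exp (p * ε / 4)) := by
  set N := Fintype.card V with hN
  have hfactor (v : V) :
      chiSquareMoment (r v) s ≤ ENNReal.ofReal (Real.exp (p * ε / 4 / N)) := by
    have hN1 : (1 : ℝ) ≤ N := Nat.one_le_cast.2 (Fintype.card_pos_iff.2 ⟨v⟩)
    have hp1 : (1 : ℝ) ≤ p := Nat.one_le_cast.2 (Nat.one_le_iff_ne_zero.2 hp0)
    have hmr : (m : ℝ) ≤ r v := Nat.cast_le.2 (hr v)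
    have hNr : 16 * (N * p) ≤ r v * ε := by nlinarith
    have hpr : 16 * (p : ℝ) ≤ r v := by nlinarith
    refine (chiSquareMoment_le_of_abs_eq hp0 ?_ hs).trans ?_
    · exact_mod_cast (by linarith : 4 * (p : ℝ) ≤ r v)
    · refine ENNReal.ofReal_le_ofReal (Real.exp_le_exp.2 ?_)
      rw [div_div, div_le_div_iff₀ (by linarith) (by positivity)]
      nlinarith
  calc ∏ v, chiSquareMoment (r v) s
      ≤ ∏ _v : V, ENNReal.ofReal (Real.exp (p * ε / 4 / N)) := by gcongr with v; exact hfactor v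
    _ = ENNReal.ofReal (Real.exp (N * (p * ε / 4 / N))) := by
      rw [Finset.prod_const, Finset.card_univ, ← hN, ← ENNReal.ofReal_pow (Real.exp_pos _).le,
        ← Real.exp_nat_mul]
    _ ≤ ENNReal.ofReal (Real.exp (p * ε / 4)) := by
      gcongr
      exact (mul_div_left_comm _ _ _).trans_le
        (mul_le_of_le_one_right (by positivity) (div_self_le_one _))

lemma exp_half_le_one_add {x : ℝ} (hx : 0 ≤ x) (hx1 : x ≤ 1) : Real.exp (x / 2) ≤ 1 + x := by
  refine (Real.exp_bound_div_one_sub_of_interval (by linarith) (by linarith)).trans ?_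
  rw [div_le_iff₀ (by linarith)]
  nlinarith

section Concentration

variable {Ω : Type*} [MeasurableSpace Ω] {P : Measure Ω} {Y : Ω → ℝ}

lemma measureReal_le_of_lintegral_le [IsFiniteMeasure P] {f : Ω → ENNReal} (hf : AEMeasurable f P)
    {a B : ℝ} (hB : 0 ≤ B) (h : ∫⁻ ω, f ω ∂P ≤ ENNReal.ofReal B) :
    P.real {ω | ENNReal.ofReal (Real.exp a) ≤ f ω} ≤ B * Real.exp (-a) := by
  refine ENNReal.toReal_le_of_le_ofReal (by positivity)
    ((meas_ge_le_lintegral_div hf (by simp [Real.exp_pos]) ENNReal.ofReal_ne_top).trans ?_)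
  rw [Real.exp_neg, ← div_eq_mul_inv, ENNReal.ofReal_div_of_pos (Real.exp_pos _)]
  gcongr

lemma ofReal_exp_mul (p : ℕ) (a : ℝ) :
    ENNReal.ofReal (Real.exp (p * a)) = ENNReal.ofReal (Real.exp a) ^ (p : ℝ) := by
  rw [ENNReal.rpow_natCast, ← ENNReal.ofReal_pow (Real.exp_pos _).le, ← Real.exp_nat_mul]

lemma measureReal_lt_abs_sub_one_le [IsFiniteMeasure P] (hY : AEMeasurable Y P) {ε B : ℝ}
    (hε : 0 < ε) (hε1 : ε ≤ 1) (hB : 0 ≤ B) {p : ℕ}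
    (hmoment : ∀ s : ℝ, |s| = p → ∫⁻ ω, ENNReal.ofReal (Y ω) ^ s ∂P ≤ ENNReal.ofReal B) :
    P.real {ω | ε < |Y ω - 1|} ≤ 2 * (B * Real.exp (-(p * (ε / 2)))) := by
  let tail (s : ℝ) : Set Ω :=
    {ω | ENNReal.ofReal (Real.exp (p * (ε / 2))) ≤ ENNReal.ofReal (Y ω) ^ s}
  have hmarkov (s : ℝ) (hs : |s| = p) : P.real (tail s) ≤ B * Real.exp (-(p * (ε / 2))) :=
    measureReal_le_of_lintegral_le (by fun_prop) hB (hmoment s hs)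
  have hsub : {ω | ε < |Y ω - 1|} ⊆ tail p ∪ tail (-p) := by
    intro ω hω
    rcases lt_abs.1 (Set.mem_ofPred_eq ▸ hω) with h | h
    · left
      rw [Set.mem_ofPred_eq, ofReal_exp_mul]
      gcongr
      linarith [exp_half_le_one_add hε.le hε1]
    · right
      have hY : Y ω ≤ Real.exp (-(ε / 2)) := by linarith [Real.add_one_le_exp (-(ε / 2))]
      rw [Set.mem_ofPred_eq, ENNReal.rpow_neg, ENNReal.le_inv_iff_le_inv,
        ← ENNReal.ofReal_inv_of_pos (Real.exp_pos _), ← Real.exp_neg, ← mul_neg, ofReal_exp_mul]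
      gcongr
  calc P.real {ω | ε < |Y ω - 1|} ≤ P.real (tail p ∪ tail (-p)) := measureReal_mono hsub
    _ ≤ P.real (tail p) + P.real (tail (-p)) := measureReal_union_le _ _
    _ ≤ 2 * (B * Real.exp (-(p * (ε / 2)))) := by
      linarith [hmarkov p (by simp), hmarkov (-p) (by simp)]

end Concentration

lemma exists_moment_order {ε δ δ₀ : ℝ} (hε : 0 < ε) (hε1 : ε ≤ 1) (hδ : 0 < δ) (hδδ₀ : δ ≤ δ₀)
    (hδ₀ : δ₀ < 1) {n m : ℕ}
    (hm : 80 * (1 + 1 / Real.log (1 / δ₀)) * (n * Real.log (1 / δ) / ε ^ 2) ≤ m) :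
    ∃ p : ℕ, p ≠ 0 ∧ 16 * n * p ≤ m * ε ∧ 2 * Real.exp (-(p * ε / 4)) < δ := by
  set L := Real.log (1 / δ) with hL
  have hδ₀' : 0 < δ₀ := hδ.trans_le hδδ₀
  have hL₀ : 0 < Real.log (1 / δ₀) := Real.log_pos (by rwa [one_lt_div hδ₀'])
  have hLL : Real.log (1 / δ₀) ≤ L :=
    Real.log_le_log (one_div_pos.2 hδ₀') (one_div_le_one_div_of_le hδ hδδ₀)
  have hL0 : 0 < L := hL₀.trans_le hLL
  have hsize : 80 * n * (L + 1) / ε ≤ m * ε := by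
    have hL1 : L + 1 ≤ (1 + 1 / Real.log (1 / δ₀)) * L := by
      have : 1 ≤ 1 / Real.log (1 / δ₀) * L := by rwa [one_div_mul_eq_div, one_le_div hL₀]
      linarith
    calc 80 * n * (L + 1) / ε ≤ 80 * n * ((1 + 1 / Real.log (1 / δ₀)) * L) / ε := by gcongr
      _ = 80 * (1 + 1 / Real.log (1 / δ₀)) * (n * L / ε ^ 2) * ε := by field_simp
      _ ≤ m * ε := by gcongr
  refine ⟨⌈4 * (L + 1) / ε⌉₊, (Nat.ceil_pos.2 (by positivity)).ne', ?_, ?_⟩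
  · have hp : (⌈4 * (L + 1) / ε⌉₊ : ℝ) ≤ 5 * (L + 1) / ε := by
      have hone : 1 ≤ (L + 1) / ε := by rw [one_le_div hε]; linarith
      calc (⌈4 * (L + 1) / ε⌉₊ : ℝ) ≤ 4 * (L + 1) / ε + 1 :=
            (Nat.ceil_lt_add_one (by positivity)).le
        _ ≤ 4 * (L + 1) / ε + (L + 1) / ε := by gcongr
        _ = 5 * (L + 1) / ε := by ring
    calc 16 * n * (⌈4 * (L + 1) / ε⌉₊ : ℝ) ≤ 16 * n * (5 * (L + 1) / ε) := by gcongr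
      _ = 80 * n * (L + 1) / ε := by ring
      _ ≤ m * ε := hsize
  · have hp : L + 1 ≤ ⌈4 * (L + 1) / ε⌉₊ * ε / 4 := by
      have := Nat.le_ceil (4 * (L + 1) / ε)
      rw [div_le_iff₀ hε] at this
      linarith
    have hδL : Real.exp (-L) = δ := by rw [hL, one_div, Real.log_inv, neg_neg, Real.exp_log hδ]
    calc 2 * Real.exp (-(⌈4 * (L + 1) / ε⌉₊ * ε / 4)) ≤ 2 * Real.exp (-(L + 1)) := by gcongr
      _ = 2 * Real.exp (-1) * δ := by rw [neg_add, Real.exp_add, hδL]; ring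
      _ < 1 * δ := by
        gcongr
        rw [Real.exp_neg, ← div_eq_mul_inv, div_lt_one (Real.exp_pos _)]
        linarith [Real.exp_one_gt_d9]
      _ = δ := one_mul δ

section MarginalSum

variable {E : Type*} [DecidableEq E] {X : E → Type*}

lemma apply_updateFinset_of_dependsOn {α : Type*} {F : (∀ e, X e) → α} {U : Set E}
    (hF : DependsOn F U) {S : Finset E} (hSU : Disjoint (S : Set E) U) (l : ∀ e, X e)
    (y : ∀ e : S, X e) : F (Function.updateFinset l S y) = F l :=
  hF fun _ he => dif_neg fun heS => hSU.notMem_of_mem_right he heS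

variable [∀ e, Fintype (X e)]

/-- The sum of `F` over the coordinates in `S`, a function of the remaining coordinates: the
counterpart for sums of `MeasureTheory.lmarginal`. -/
def marginalSum (S : Finset E) (F : (∀ e, X e) → ℝ) (l : ∀ e, X e) : ℝ :=
  ∑ y : (∀ e : S, X e), F (Function.updateFinset l S y)

lemma marginalSum_empty (F : (∀ e, X e) → ℝ) : marginalSum ∅ F = F := by
  ext l
  simp [marginalSum]

lemma marginalSum_union {S U : Finset E} (h : Disjoint S U) (F : (∀ e, X e) → ℝ) :
    marginalSum (S ∪ U) F = marginalSum S (marginalSum U F) := by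
  ext l
  simp only [marginalSum, Function.updateFinset_updateFinset h]
  rw [← Fintype.sum_prod_type']
  exact (Fintype.sum_equiv (Equiv.piFinsetUnion X h) _ _ fun _ => rfl).symm

lemma marginalSum_mul_left {G : (∀ e, X e) → ℝ} {U : Set E} (hG : DependsOn G U) {S : Finset E}
    (hSU : Disjoint (S : Set E) U) (F : (∀ e, X e) → ℝ) (l : ∀ e, X e) :
    marginalSum S (fun l => G l * F l) l = G l * marginalSum S F l := by
  simp only [marginalSum, apply_updateFinset_of_dependsOn hG hSU, Finset.mul_sum]

lemma dependsOn_marginalSum {F : (∀ e, X e) → ℝ} {U : Set E} (hF : DependsOn F U) (S : Finset E) :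
    DependsOn (marginalSum S F) (U \ S) := fun _ _ h =>
  Finset.sum_congr rfl fun y _ => hF.updateFinset y h

lemma marginalSum_eq_sum_of_range {Y : Type*} [Fintype Y] {S : Finset E} {l : ∀ e, X e}
    {g : Y → ∀ e, X e} (hg : Function.Injective g)
    (hrange : ∀ l', l' ∈ Set.range g ↔ ∀ e ∉ S, l' e = l e) (F : (∀ e, X e) → ℝ) :
    marginalSum S F l = ∑ y, F (g y) := by
  have hupdate (y : Y) : Function.updateFinset l S (fun e : S => g y e) = g y := by
    ext e
    by_cases he : e ∈ S
    · simp [Function.updateFinset, he]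
    · simp [Function.updateFinset, he, (hrange (g y)).1 ⟨y, rfl⟩ e he]
  refine (Fintype.sum_bijective (fun y (e : S) => g y e) ⟨fun y y' h => hg ?_, fun z => ?_⟩ _ _
    fun y => by rw [hupdate]).symm
  · rw [← hupdate y, ← hupdate y']
    exact congrArg _ h
  · obtain ⟨y, hy⟩ := (hrange (Function.updateFinset l S z)).2
      fun e he => by simp [Function.updateFinset, he]
    exact ⟨y, by simp [hy, Function.updateFinset]⟩

end MarginalSum

lemma IsIIDStandardNormal.map_eq_pi {V : Type*} [Fintype V] {K : V → Type*} [∀ v, Fintype (K v)]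
    {Ω : Type*} [MeasurableSpace Ω] {P : Measure Ω} {Z : (v : V) → K v → Ω → ℝ}
    (h : IsIIDStandardNormal P Z) :
    P.map (fun ω v k => Z v k ω) =
      Measure.pi fun v => Measure.pi fun _ : K v => gaussianReal 0 1 := by
  have hZ (p : (v : V) × K v) : AEMeasurable (Z p.1 p.2) P := (h.1 p.1 p.2).aemeasurable
  have hjoint : P.map (fun ω (p : (v : V) × K v) => Z p.1 p.2 ω) =
      Measure.pi fun _ => gaussianReal 0 1 := by
    rw [h.2.map_fun_eq_pi_map hZ]
    congr 1 with p
    rw [(h.1 p.1 p.2).map_eq]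
  have hcurry := Measure.infinitePi_map_piCurry (κ := K) (fun _ _ => gaussianReal 0 1)
  simp only [Measure.infinitePi_eq_pi] at hcurry
  rw [← hcurry, ← hjoint,
    AEMeasurable.map_map_of_aemeasurable (by fun_prop) (aemeasurable_pi_lambda _ hZ)]
  rfl

lemma exists_adj_dist_lt {V : Type*} {G : SimpleGraph V} {r v : V} (h : G.Reachable v r)
    (hne : v ≠ r) : ∃ w, G.Adj v w ∧ G.dist w r < G.dist v r := by
  obtain ⟨p, hp⟩ := h.exists_walk_length_eq_dist
  cases p with
  | nil => exact absurd rfl hne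
  | cons hadj q =>
    rw [SimpleGraph.Walk.length_cons] at hp
    exact ⟨_, hadj, (G.dist_le q).trans_lt (hp ▸ Nat.lt_succ_self _)⟩

lemma exists_equiv_fin_lt_of_lt {V α : Type*} [Fintype V] [LinearOrder α] (f : V → α) :
    ∃ τ : V ≃ Fin (Fintype.card V), ∀ u v, f u < f v → τ u < τ v := by
  let g := f ∘ (Fintype.equivFin V).symm
  refine ⟨(Fintype.equivFin V).trans (Tuple.sort g).symm, fun u v huv => ?_⟩
  by_contra! hle
  have := Tuple.monotone_sort g hle
  simp only [g, Function.comp_apply, Equiv.trans_apply, Equiv.apply_symm_apply,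
    Equiv.symm_apply_apply] at this
  exact this.not_gt huv

namespace TensorNetworkEmbedding

variable {V I O : Type*} (T : TensorNetworkEmbedding V I O)

/-- Assignments of an index to every edge of the network. -/
abbrev Label : Type _ := (e : T.Edge) → Fin (T.size e)

section Schedule

variable [Fintype V] (σ : V ≃ Fin (Fintype.card V))

/-- When the tensors are applied to the input in the order `σ`, the tensor at `v` in step
`σ v + 1`, this is the step after which the edge belongs to the intermediate array. -/
def birth : T.Edge → ℕ
  | Sum.inl e => ((e : Sym2 V).map σ).inf + 1
  | Sum.inr (Sum.inl _) => 0
  | Sum.inr (Sum.inr o) => σ (T.outVertex o) + 1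

/-- When the tensors are applied to the input in the order `σ`, the tensor at `v` in step
`σ v + 1`, this is the step in which the edge is summed over. Output edges never are, which is
encoded by a step beyond the last one. -/
def death : T.Edge → ℕ
  | Sum.inl e => ((e : Sym2 V).map σ).sup + 1
  | Sum.inr (Sum.inl i) => σ (T.inVertex i) + 1
  | Sum.inr (Sum.inr _) => Fintype.card V + 1

lemma birth_lt_death (e : T.Edge) : T.birth σ e < T.death σ e := by
  rcases e with ⟨e, he⟩ | i | o
  · induction e using Sym2.ind with
    | _ a b =>
      have hab : (σ a : ℕ) ≠ σ b := fun h => T.graph.ne_of_adj he (σ.injective (Fin.ext h))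
      simp only [birth, death, Sym2.map_mk, Sym2.inf_mk, Sym2.sup_mk, Fin.coe_min, Fin.coe_max]
      omega
  · exact Nat.succ_pos _
  · exact Nat.succ_lt_succ (σ _).isLt

lemma incident_iff (e : T.Edge) (v : V) :
    T.Incident e v ↔ T.birth σ e = σ v + 1 ∨ T.death σ e = σ v + 1 := by
  rcases e with ⟨e, he⟩ | i | o
  · induction e using Sym2.ind with
    | _ a b =>
      simp only [Incident, birth, death, Sym2.map_mk, Sym2.inf_mk, Sym2.sup_mk, Sym2.mem_iff,
        Fin.coe_min, Fin.coe_max, ← σ.injective.eq_iff, Fin.ext_iff]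
      omega
  · simp [Incident, birth, death, Fin.val_inj]
  · have := (σ v).isLt
    simp [Incident, birth, death, Fin.val_inj, this.ne']

variable [Fintype I] [Fintype O]

open Classical in
/-- The edges which are rows of the tensor at `v`, unfolded according to the order `σ`. -/
noncomputable def rows (v : V) : Finset T.Edge := {e | T.birth σ e = σ v + 1}

open Classical in
/-- The edges which are columns of the tensor at `v`, unfolded according to the order `σ`. -/
noncomputable def cols (v : V) : Finset T.Edge := {e | T.death σ e = σ v + 1}

open Classical in
/-- The edges of the array that is obtained from the input in the first `k` steps. -/
noncomputable def live (k : ℕ) : Finset T.Edge := {e | T.birth σ e ≤ k ∧ k < T.death σ e}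

open Classical in
/-- The edges which are summed over in the first `k` steps. -/
noncomputable def contracted (k : ℕ) : Finset T.Edge := {e | T.death σ e ≤ k}

open Classical in
/-- The edges of the intermediate array that the tensor at `v` does not touch. -/
noncomputable def bystanders (v : V) : Finset T.Edge :=
  {e | T.birth σ e ≤ σ v ∧ σ v + 1 < T.death σ e}

variable {T σ} {e : T.Edge} {v : V} {k : ℕ}

@[simp] lemma mem_rows : e ∈ T.rows σ v ↔ T.birth σ e = σ v + 1 := by simp [rows]

@[simp] lemma mem_cols : e ∈ T.cols σ v ↔ T.death σ e = σ v + 1 := by simp [cols]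

@[simp] lemma mem_live : e ∈ T.live σ k ↔ T.birth σ e ≤ k ∧ k < T.death σ e := by simp [live]

@[simp] lemma mem_contracted : e ∈ T.contracted σ k ↔ T.death σ e ≤ k := by simp [contracted]

@[simp] lemma mem_bystanders :
    e ∈ T.bystanders σ v ↔ T.birth σ e ≤ σ v ∧ σ v + 1 < T.death σ e := by simp [bystanders]

lemma disjoint_rows_cols : Disjoint (T.rows σ v) (T.cols σ v) :=
  Finset.disjoint_left.2 fun e hr hc => by
    have := T.birth_lt_death σ e
    simp only [mem_rows, mem_cols] at hr hc
    omega

lemma disjoint_bystanders_rows : Disjoint (T.bystanders σ v) (T.rows σ v) :=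
  Finset.disjoint_left.2 fun e hb hr => by
    simp only [mem_bystanders, mem_rows] at hb hr
    omega

lemma disjoint_bystanders_cols : Disjoint (T.bystanders σ v) (T.cols σ v) :=
  Finset.disjoint_left.2 fun e hb hc => by
    simp only [mem_bystanders, mem_cols] at hb hc
    omega

lemma disjoint_cols_contracted : Disjoint (T.cols σ v) (T.contracted σ (σ v)) :=
  Finset.disjoint_left.2 fun e hc hk => by
    simp only [mem_cols, mem_contracted] at hc hk
    omega

lemma contracted_succ [DecidableEq T.Edge] :
    T.contracted σ (σ v + 1) = T.cols σ v ∪ T.contracted σ (σ v) := by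
  ext e
  simp only [mem_contracted, Finset.mem_union, mem_cols]
  omega

lemma live_eq_bystanders_union_cols [DecidableEq T.Edge] :
    T.live σ (σ v) = T.bystanders σ v ∪ T.cols σ v := by
  ext e
  have := T.birth_lt_death σ e
  simp only [mem_live, Finset.mem_union, mem_bystanders, mem_cols]
  omega

lemma live_succ_eq_bystanders_union_rows [DecidableEq T.Edge] :
    T.live σ (σ v + 1) = T.bystanders σ v ∪ T.rows σ v := by
  ext e
  have := T.birth_lt_death σ e
  simp only [mem_live, Finset.mem_union, mem_bystanders, mem_rows]
  omega

end Schedule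

section State

variable [Fintype V] [Fintype I] [Fintype O] [DecidableEq T.Edge]
  (σ : V ≃ Fin (Fintype.card V)) (x : T.InIndex → ℝ)

/-- The array obtained from the input `x` by applying the first `k` tensors in the order `σ`, as a
function of a label of which only the values on live edges matter. -/
noncomputable def state (A : (v : V) → T.TensorIndex v → ℝ) (k : ℕ) : T.Label → ℝ :=
  marginalSum (T.contracted σ k) fun l =>
    (∏ v with σ v < k, A v (fun e => l e.1)) * x (fun i => l (Sum.inr (Sum.inl i)))

/-- The sum of the squares of the entries of `TensorNetworkEmbedding.state`. -/
noncomputable def energy (A : (v : V) → T.TensorIndex v → ℝ) (k : ℕ) : T.Label → ℝ :=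
  marginalSum (T.live σ k) fun l => T.state σ x A k l ^ 2

variable {T σ x} {A : (v : V) → T.TensorIndex v → ℝ} {v : V} {k : ℕ}

lemma dependsOn_state : DependsOn (T.state σ x A k) (T.live σ k : Set T.Edge) := by
  refine (dependsOn_marginalSum (U := {e | T.birth σ e ≤ k}) (fun l l' h => ?_) _).mono ?_
  · have hA : ∀ v ∈ Finset.univ.filter (fun v => (σ v : ℕ) < k),
        A v (fun e => l e.1) = A v (fun e => l' e.1) := fun v hv => by
      refine congrArg (A v) (funext fun e => h e.1 ?_)
      have he := (T.incident_iff σ e.1 v).1 e.2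
      have := T.birth_lt_death σ e.1
      have hvk := (Finset.mem_filter.1 hv).2
      simp only [Set.mem_ofPred_eq]
      omega
    have hx : x (fun i => l (Sum.inr (Sum.inl i))) = x (fun i => l' (Sum.inr (Sum.inl i))) :=
      congrArg x (funext fun i => h _ (Nat.zero_le k))
    rw [Finset.prod_congr rfl hA, hx]
  · intro e he
    simpa using he

lemma filter_lt_succ : Finset.univ.filter (fun u => (σ u : ℕ) < σ v + 1) =
    Finset.cons v (Finset.univ.filter fun u => (σ u : ℕ) < σ v) (by simp) := by
  ext u
  simp [Order.lt_add_one_iff, le_iff_eq_or_lt, Fin.val_inj]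

lemma state_succ (l : T.Label) :
    T.state σ x A (σ v + 1) l =
      marginalSum (T.cols σ v) (fun l => A v (fun e => l e.1) * T.state σ x A (σ v) l) l := by
  have hdep : DependsOn (fun l : T.Label => A v (fun e => l e.1)) {e | T.Incident e v} :=
    fun l l' h => congrArg (A v) (funext fun e => h e.1 e.2)
  have hdisj : Disjoint (T.contracted σ (σ v) : Set T.Edge) {e | T.Incident e v} :=
    Set.disjoint_left.2 fun e hc he => by
      have := (T.incident_iff σ e v).1 he
      have := T.birth_lt_death σ e
      simp only [Finset.mem_coe, mem_contracted] at hc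
      omega
  rw [state, contracted_succ, marginalSum_union disjoint_cols_contracted]
  simp only [filter_lt_succ, Finset.prod_cons, mul_assoc]
  exact congrArg (marginalSum _ · l) (funext fun l => marginalSum_mul_left hdep hdisj _ l)

lemma state_congr {A' : (v : V) → T.TensorIndex v → ℝ} (h : ∀ v, σ v < k → A v = A' v) :
    T.state σ x A k = T.state σ x A' k := by
  refine congrArg _ (funext fun l => congrArg (· * _) (Finset.prod_congr rfl fun v hv => ?_))
  rw [h v (Finset.mem_filter.1 hv).2]

lemma measurable_state (k : ℕ) (l : T.Label) : Measurable fun A => T.state σ x A k l := by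
  unfold state marginalSum
  fun_prop

lemma measurable_energy (k : ℕ) (l : T.Label) : Measurable fun A => T.energy σ x A k l :=
  Finset.measurable_sum _ fun _ _ => (measurable_state k _).pow_const 2

/-- The multi-index of the tensor at `v` with the given row and column; the label is only a
default value. -/
noncomputable def unfoldedIndex (v : V) (l : T.Label) (o : (e : T.rows σ v) → Fin (T.size e))
    (c : (e : T.cols σ v) → Fin (T.size e)) : T.TensorIndex v := fun e =>
  Function.updateFinset (Function.updateFinset l (T.rows σ v) o) (T.cols σ v) c e.1

lemma unfoldedIndex_injective2 (v : V) (l : T.Label) :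
    Function.Injective2 (T.unfoldedIndex (σ := σ) v l) := by
  intro o o' c c' h
  have hinc (e : T.Edge) (he : T.Incident e v) := congrFun h ⟨e, he⟩
  simp only [unfoldedIndex] at hinc
  refine ⟨funext fun e => ?_, funext fun e => ?_⟩
  · have he := hinc e.1 ((T.incident_iff σ _ _).2 (Or.inl (mem_rows.1 e.2)))
    simpa [Function.updateFinset, Finset.disjoint_left.1 disjoint_rows_cols e.2] using he
  · have he := hinc e.1 ((T.incident_iff σ _ _).2 (Or.inr (mem_cols.1 e.2)))
    simpa [Function.updateFinset] using he

lemma energy_eq_sum_cols (l : T.Label) :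
    T.energy σ x A (σ v) l =
      ∑ r : (e : T.bystanders σ v) → Fin (T.size e), ∑ c : (e : T.cols σ v) → Fin (T.size e),
        T.state σ x A (σ v) (Function.updateFinset (Function.updateFinset l _ r) _ c) ^ 2 := by
  rw [energy, live_eq_bystanders_union_cols, marginalSum_union disjoint_bystanders_cols]
  rfl

lemma state_succ_updateFinset (l : T.Label) (r : (e : T.bystanders σ v) → Fin (T.size e))
    (o : (e : T.rows σ v) → Fin (T.size e)) :
    T.state σ x A (σ v + 1) (Function.updateFinset (Function.updateFinset l _ r) _ o) =
      ∑ c, A v (unfoldedIndex v l o c) * T.state σ x A (σ v)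
        (Function.updateFinset (Function.updateFinset l _ r) (T.cols σ v) c) := by
  have hA (c : (e : T.cols σ v) → Fin (T.size e)) (e : {e // T.Incident e v}) :
      Function.updateFinset (Function.updateFinset (Function.updateFinset l _ r) _ o) _ c e.1 =
        unfoldedIndex v l o c e := by
    have he := (T.incident_iff σ e.1 v).1 e.2
    by_cases hc : e.1 ∈ T.cols σ v
    · simp [unfoldedIndex, Function.updateFinset, hc]
    · have hr : e.1 ∈ T.rows σ v := mem_rows.2 (he.resolve_right (mem_cols.not.1 hc))
      simp [unfoldedIndex, Function.updateFinset, hc, hr]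
  have hstate (c : (e : T.cols σ v) → Fin (T.size e)) :
      T.state σ x A (σ v) (Function.updateFinset
          (Function.updateFinset (Function.updateFinset l _ r) _ o) (T.cols σ v) c) =
        T.state σ x A (σ v) (Function.updateFinset (Function.updateFinset l _ r) _ c) := by
    refine dependsOn_state fun e he => ?_
    have hr : e ∉ T.rows σ v := by
      simp only [Finset.mem_coe, mem_live] at he
      rw [mem_rows]
      omega
    simp [Function.updateFinset, hr]
  rw [state_succ, marginalSum]
  exact Finset.sum_congr rfl fun c _ => congrArg₂ _ (congrArg (A v) (funext (hA c))) (hstate c)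

lemma energy_succ (l : T.Label) :
    T.energy σ x A (σ v + 1) l =
      ∑ r : (e : T.bystanders σ v) → Fin (T.size e), ∑ o : (e : T.rows σ v) → Fin (T.size e),
        (∑ c, A v (unfoldedIndex v l o c) * T.state σ x A (σ v)
          (Function.updateFinset (Function.updateFinset l _ r) (T.cols σ v) c)) ^ 2 := by
  rw [energy, live_succ_eq_bystanders_union_rows, marginalSum_union disjoint_bystanders_rows]
  exact Finset.sum_congr rfl fun r _ => Finset.sum_congr rfl fun o _ =>
    congrArg (· ^ 2) (state_succ_updateFinset l r o)

end State

section RowSize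

variable [Fintype V] (σ : V ≃ Fin (Fintype.card V))

lemma exists_later_neighbor_iff (e : T.graph.edgeSet) (v : V) :
    (∃ u, (e : Sym2 V) = s(v, u) ∧ σ v < σ u) ↔ ((e : Sym2 V).map σ).inf = σ v := by
  obtain ⟨e, he⟩ := e
  induction e using Sym2.ind with
  | _ a b =>
    have hab : σ a ≠ σ b := σ.injective.ne (T.graph.ne_of_adj he)
    simp only [Sym2.map_mk, Sym2.inf_mk, Sym2.eq_iff]
    constructor
    · rintro ⟨u, ⟨rfl, rfl⟩ | ⟨rfl, rfl⟩, h⟩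
      · exact inf_eq_left.2 h.le
      · exact inf_eq_right.2 h.le
    · intro h
      rcases hab.lt_or_gt with hlt | hlt
      · rw [inf_eq_left.2 hlt.le, σ.injective.eq_iff] at h
        exact ⟨b, Or.inl ⟨h, rfl⟩, h ▸ hlt⟩
      · rw [inf_eq_right.2 hlt.le, σ.injective.eq_iff] at h
        exact ⟨a, Or.inr ⟨rfl, h⟩, h ▸ hlt⟩

variable [Fintype O]

open Classical in
lemma prod_rowSize :
    ∏ v, T.rowSize σ v = (∏ o, T.outDim o) * ∏ e, T.bondDim e := by
  simp only [rowSize, Finset.prod_mul_distrib, exists_later_neighbor_iff]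
  congr 1
  · exact Finset.prod_fiberwise _ _ _
  · rw [← Finset.prod_fiberwise _ (fun e : T.graph.edgeSet => σ.symm ((e : Sym2 V).map σ).inf)]
    simp only [Equiv.symm_apply_eq]

variable {T σ} in
lemma nonempty_label [Nonempty T.InIndex] (hr : ∀ v, T.rowSize σ v ≠ 0) : Nonempty T.Label := by
  classical
  have hprod := Finset.prod_ne_zero_iff.2 fun v (_ : v ∈ Finset.univ) => hr v
  rw [prod_rowSize, mul_ne_zero_iff, Finset.prod_ne_zero_iff, Finset.prod_ne_zero_iff] at hprod
  obtain ⟨i⟩ := ‹Nonempty T.InIndex›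
  exact ⟨T.label (fun o => ⟨0, Nat.pos_of_ne_zero (hprod.1 o (Finset.mem_univ _))⟩) i
    fun e => ⟨0, Nat.pos_of_ne_zero (hprod.2 e (Finset.mem_univ _))⟩⟩

lemma embeddingMatrix_eq (τ : V ≃ Fin (Fintype.card V)) {Ω : Type*}
    (Z : (v : V) → T.TensorIndex v → Ω → ℝ) : T.embeddingMatrix σ Z = T.embeddingMatrix τ Z := by
  have hprod (σ : V ≃ Fin (Fintype.card V)) :
      ∏ v, 1 / √(T.rowSize σ v : ℝ) = 1 / √((∏ v, T.rowSize σ v : ℕ) : ℝ) := by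
    rw [Finset.prod_div_distrib, Finset.prod_const_one, Nat.cast_prod,
      Real.sqrt_prod _ fun _ _ => Nat.cast_nonneg _]
  ext ω o i
  simp only [embeddingMatrix, contract, Finset.prod_mul_distrib, hprod, prod_rowSize]

lemma card_rows_pi [Fintype I] [DecidableEq T.Edge] (v : V) :
    Fintype.card ((e : T.rows σ v) → Fin (T.size e)) = T.rowSize σ v := by
  classical
  rw [Fintype.card_pi, Finset.prod_coe_sort (T.rows σ v) fun e => Fintype.card (Fin (T.size e)),
    rows, Finset.prod_filter, Fintype.prod_sum_type, Fintype.prod_sum_type, mul_comm]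
  simp only [birth, rowSize, exists_later_neighbor_iff, Finset.prod_filter, Fintype.card_fin,
    Fin.val_inj, σ.injective.eq_iff, add_left_inj]
  simp [size]

end RowSize

section Moments

variable [Fintype V] [Fintype I] [Fintype O] (σ : V ≃ Fin (Fintype.card V))

/-- The tensors of the embedding whose entries before normalization are those of `A`. -/
noncomputable def normalized (A : (v : V) → T.TensorIndex v → ℝ) (v : V) : T.TensorIndex v → ℝ :=
  fun k => (1 / √(T.rowSize σ v : ℝ)) * A v k

variable {T σ} [DecidableEq T.Edge] {x : T.InIndex → ℝ} {A : (v : V) → T.TensorIndex v → ℝ} {s : ℝ}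
  [∀ v, Fintype (T.TensorIndex v)]

lemma lintegral_energy_succ_le [DecidableEq V] (hs : 1 ≤ s ∨ s < 0) (v : V) (l : T.Label) :
    ∫⁻ a, ENNReal.ofReal
        (T.energy σ x (T.normalized σ (Function.update A v a)) (σ v + 1) l) ^ s
        ∂Measure.pi (fun _ => gaussianReal 0 1) ≤
      chiSquareMoment (T.rowSize σ v) s *
        ENNReal.ofReal (T.energy σ x (T.normalized σ A) (σ v) l) ^ s := by
  have hstate (a : T.TensorIndex v → ℝ) :
      T.state σ x (T.normalized σ (Function.update A v a)) (σ v) =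
        T.state σ x (T.normalized σ A) (σ v) := by
    refine state_congr fun u hu => ?_
    have huv : u ≠ v := by
      rintro rfl
      exact lt_irrefl _ hu
    ext i
    simp only [normalized, Function.update_of_ne huv]
  let X (r : (e : T.bystanders σ v) → Fin (T.size e)) (c : (e : T.cols σ v) → Fin (T.size e)) : ℝ :=
    T.state σ x (T.normalized σ A) (σ v)
      (Function.updateFinset (Function.updateFinset l _ r) (T.cols σ v) c)
  have henergy (a : T.TensorIndex v → ℝ) :
      T.energy σ x (T.normalized σ (Function.update A v a)) (σ v + 1) l =
        (∑ r, ∑ o, (∑ c, a (unfoldedIndex v l o c) * X r c) ^ 2) /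
          Fintype.card ((e : T.rows σ v) → Fin (T.size e)) := by
    simp only [energy_succ, hstate, normalized, Function.update_self,
      div_mul_eq_mul_div, one_mul, ← Finset.sum_div, div_pow, Real.sq_sqrt (Nat.cast_nonneg _),
      T.card_rows_pi, X]
  simp only [henergy, energy_eq_sum_cols, ← T.card_rows_pi σ v]
  exact lintegral_contract_rpow_le (unfoldedIndex_injective2 v l) X hs

lemma lmarginal_energy_le [DecidableEq V] (hs : 1 ≤ s ∨ s < 0) (l : T.Label) {k : ℕ}
    (hk : k ≤ Fintype.card V) :
    lmarginal (fun v => Measure.pi fun _ : T.TensorIndex v => gaussianReal 0 1)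
        (Finset.univ.filter fun v => (σ v : ℕ) < k)
        (fun A => ENNReal.ofReal (T.energy σ x (T.normalized σ A) k l) ^ s) A ≤
      (∏ v with σ v < k, chiSquareMoment (T.rowSize σ v) s) *
        ENNReal.ofReal (T.energy σ x (T.normalized σ A) 0 l) ^ s := by
  induction k generalizing A with
  | zero => simp
  | succ k ih =>
    obtain ⟨v, rfl⟩ : ∃ v, (σ v : ℕ) = k := ⟨σ.symm ⟨k, hk⟩, by simp⟩
    have hmeas (k : ℕ) : Measurable fun A =>
        ENNReal.ofReal (T.energy σ x (T.normalized σ A) k l) ^ s :=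
      ((measurable_energy k l).comp (by unfold normalized; fun_prop)).ennreal_ofReal.pow_const s
    have hv : v ∉ Finset.univ.filter fun u => (σ u : ℕ) < σ v := by simp
    rw [filter_lt_succ, Finset.cons_eq_insert, lmarginal_insert' _ (hmeas _) hv,
      Finset.prod_insert hv, mul_assoc]
    refine (lmarginal_mono (fun A => lintegral_energy_succ_le (A := A) hs v l) A).trans ?_
    exact (lintegral_const_mul _ ((hmeas _).comp measurable_updateFinset)).trans_le
      (mul_le_mul_right (ih (Nat.le_of_succ_le hk)) _)

end Moments

section Endpoints

variable [Fintype V] [Fintype I] [Fintype O] [DecidableEq I] [DecidableEq T.Edge]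
  {T} {σ : V ≃ Fin (Fintype.card V)} {x : T.InIndex → ℝ} {A : (v : V) → T.TensorIndex v → ℝ}

lemma energy_zero (l : T.Label) : T.energy σ x A 0 l = ∑ i, x i ^ 2 := by
  have hcontracted : T.contracted σ 0 = ∅ :=
    Finset.eq_empty_of_forall_notMem fun e he =>
      (T.birth_lt_death σ e).not_ge ((mem_contracted.1 he).trans (Nat.zero_le _))
  have hstate (l : T.Label) : T.state σ x A 0 l = x (fun i => l (Sum.inr (Sum.inl i))) := by
    rw [state, hcontracted, marginalSum_empty]
    simp
  let g (i : T.InIndex) : T.Label :=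
    T.label (fun o => l (Sum.inr (Sum.inr o))) i (fun e => l (Sum.inl e))
  have hg : Function.Injective g := fun i i' h =>
    funext fun k => congrFun h (Sum.inr (Sum.inl k))
  have hrange (l' : T.Label) : l' ∈ Set.range g ↔ ∀ e ∉ T.live σ 0, l' e = l e := by
    constructor
    · rintro ⟨i, rfl⟩ (e | k | o) he
      · rfl
      · simp [birth, death] at he
      · rfl
    · refine fun h => ⟨fun k => l' (Sum.inr (Sum.inl k)), funext fun e => ?_⟩
      rcases e with e | k | o
      · exact (h _ (by simp [birth])).symm
      · rfl
      · exact (h _ (by simp [birth])).symm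
  rw [energy, marginalSum_eq_sum_of_range hg hrange]
  simp only [hstate]
  rfl

lemma state_card (l : T.Label) :
    T.state σ x A (Fintype.card V) l =
      (T.contract A).mulVec x fun o => l (Sum.inr (Sum.inr o)) := by
  classical
  let g (y : T.InIndex × T.BondIndex) : T.Label :=
    T.label (fun o => l (Sum.inr (Sum.inr o))) y.1 y.2
  have hg : Function.Injective g := fun y y' h => Prod.ext
    (funext fun k => congrFun h (Sum.inr (Sum.inl k))) (funext fun e => congrFun h (Sum.inl e))
  have hrange (l' : T.Label) :
      l' ∈ Set.range g ↔ ∀ e ∉ T.contracted σ (Fintype.card V), l' e = l e := by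
    constructor
    · rintro ⟨y, rfl⟩ (e | k | o) he
      · simp [death] at he
      · simp [death] at he
      · rfl
    · refine fun h => ⟨⟨fun k => l' (Sum.inr (Sum.inl k)), fun e => l' (Sum.inl e)⟩,
        funext fun e => ?_⟩
      rcases e with e | k | o
      · rfl
      · rfl
      · exact (h _ (by simp [death])).symm
  rw [state, marginalSum_eq_sum_of_range hg hrange, Fintype.sum_prod_type]
  simp only [Fin.is_lt, Finset.filter_true]
  exact Finset.sum_congr rfl fun i _ =>
    (Finset.sum_mul Finset.univ (fun b => ∏ v, A v fun e => g (i, b) e.1) (x i)).symm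

lemma energy_card [DecidableEq O] (l : T.Label) :
    T.energy σ x A (Fintype.card V) l = ∑ o, (T.contract A).mulVec x o ^ 2 := by
  let g (o : T.OutIndex) : T.Label :=
    T.label o (fun i => l (Sum.inr (Sum.inl i))) (fun e => l (Sum.inl e))
  have hg : Function.Injective g := fun o o' h =>
    funext fun k => congrFun h (Sum.inr (Sum.inr k))
  have hrange (l' : T.Label) :
      l' ∈ Set.range g ↔ ∀ e ∉ T.live σ (Fintype.card V), l' e = l e := by
    constructor
    · rintro ⟨o, rfl⟩ (e | k | o) he
      · rfl
      · rfl
      · simp [birth, death] at he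
    · refine fun h => ⟨fun k => l' (Sum.inr (Sum.inr k)), funext fun e => ?_⟩
      rcases e with e | k | o
      · exact (h _ (by simp [death])).symm
      · exact (h _ (by simp [death])).symm
      · rfl
  rw [energy, marginalSum_eq_sum_of_range hg hrange]
  simp only [state_card]
  rfl

end Endpoints

section Accuracy

variable [Fintype V] [Fintype I] [DecidableEq I] [Fintype O] [DecidableEq O]
  {T} {σ : V ≃ Fin (Fintype.card V)} {Ω : Type*} [MeasurableSpace Ω] {P : Measure Ω}
  {Z : (v : V) → T.TensorIndex v → Ω → ℝ}

lemma aemeasurable_norm_mulVec_sq (hZ : ∀ v k, AEMeasurable (Z v k) P)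
    (x : EuclideanSpace ℝ T.InIndex) :
    AEMeasurable (fun ω => ‖WithLp.toLp 2 ((T.embeddingMatrix σ Z ω).mulVec x)‖ ^ 2) P := by
  simp only [EuclideanSpace.real_norm_sq_eq, Matrix.mulVec, dotProduct, embeddingMatrix, contract,
    Matrix.of_apply]
  fun_prop

lemma lintegral_norm_mulVec_rpow_le [Nonempty T.Label] (hZ : IsIIDStandardNormal P Z) {s : ℝ}
    (hs : 1 ≤ s ∨ s < 0) (x : EuclideanSpace ℝ T.InIndex) :
    ∫⁻ ω, ENNReal.ofReal (‖WithLp.toLp 2 ((T.embeddingMatrix σ Z ω).mulVec x)‖ ^ 2) ^ s ∂P ≤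
      (∏ v, chiSquareMoment (T.rowSize σ v) s) * ENNReal.ofReal (‖x‖ ^ 2) ^ s := by
  classical
  have (v : V) : Fintype (T.TensorIndex v) := Fintype.ofFinite _
  obtain ⟨l⟩ := ‹Nonempty T.Label›
  let F (k : ℕ) (A : (v : V) → T.TensorIndex v → ℝ) : ENNReal :=
    ENNReal.ofReal (T.energy σ x (T.normalized σ A) k l) ^ s
  have hF : Measurable (F (Fintype.card V)) :=
    ((measurable_energy _ l).comp (by unfold normalized; fun_prop)).ennreal_ofReal.pow_const s
  have hnorm (ω : Ω) : ENNReal.ofReal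
      (‖WithLp.toLp 2 ((T.embeddingMatrix σ Z ω).mulVec x)‖ ^ 2) ^ s =
        F (Fintype.card V) fun v k => Z v k ω := by
    simp only [EuclideanSpace.real_norm_sq_eq, F, energy_card]
    rfl
  have hbound := lmarginal_energy_le (x := x) (A := fun _ _ => 0) (σ := σ) hs l le_rfl
  simp only [Fin.is_lt, Finset.filter_true, energy_zero, lmarginal_univ] at hbound
  simp only [hnorm]
  rw [← lintegral_map' (f := F (Fintype.card V)) hF.aemeasurable (aemeasurable_pi_lambda _ fun v =>
    aemeasurable_pi_lambda _ fun k => (hZ.1 v k).aemeasurable), hZ.map_eq_pi,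
    EuclideanSpace.real_norm_sq_eq]
  exact hbound

lemma isAccurateEmbedding_of_le_rowSize [IsFiniteMeasure P] (hZ : IsIIDStandardNormal P Z) {m : ℕ}
    (hr : ∀ v, m ≤ T.rowSize σ v) {ε δ δ₀ : ℝ} (hε : 0 < ε) (hε1 : ε ≤ 1) (hδ : 0 < δ)
    (hδδ₀ : δ ≤ δ₀) (hδ₀ : δ₀ < 1)
    (hm : 80 * (1 + 1 / Real.log (1 / δ₀)) *
      (Fintype.card V * Real.log (1 / δ) / ε ^ 2) ≤ m) :
    IsAccurateEmbedding P (T.embeddingMatrix σ Z) ε δ := by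
  intro x hx
  obtain ⟨p, hp0, hpm, hpδ⟩ := exists_moment_order hε hε1 hδ hδδ₀ hδ₀ hm
  have hr0 (v : V) : T.rowSize σ v ≠ 0 := by
    have hV : (0 : ℝ) < Fintype.card V := Nat.cast_pos.2 (Fintype.card_pos_iff.2 ⟨v⟩)
    have : (0 : ℝ) < p := Nat.cast_pos.2 (Nat.pos_of_ne_zero hp0)
    have hm0 : (0 : ℝ) < m := pos_of_mul_pos_left (lt_of_lt_of_le (by positivity) hpm) hε.le
    exact ((Nat.cast_pos.1 hm0).trans_le (hr v)).ne'
  have : Nonempty T.InIndex := by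
    by_contra h
    rw [not_nonempty_iff] at h
    simp [Subsingleton.elim x 0] at hx
  have : Nonempty T.Label := nonempty_label hr0
  have hmoment (s : ℝ) (hs : |s| = p) :
      ∫⁻ ω, ENNReal.ofReal (‖WithLp.toLp 2 ((T.embeddingMatrix σ Z ω).mulVec x)‖ ^ 2) ^ s ∂P ≤
        ENNReal.ofReal (Real.exp (p * ε / 4)) := by
    have hs' : 1 ≤ s ∨ s < 0 := by
      have hp1 : (1 : ℝ) ≤ p := Nat.one_le_cast.2 (Nat.one_le_iff_ne_zero.2 hp0)
      exact (le_abs.1 (hs ▸ hp1)).imp_right fun h => by linarith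
    refine (lintegral_norm_mulVec_rpow_le hZ hs' x).trans ?_
    simpa [hx] using prod_chiSquareMoment_le hr hp0 hε hε1 hpm hs
  refine (measureReal_lt_abs_sub_one_le
    (aemeasurable_norm_mulVec_sq (fun v k => (hZ.1 v k).aemeasurable) x)
    hε hε1 (Real.exp_pos _).le hmoment).trans_lt ?_
  have hexp : p * ε / 4 + -(p * (ε / 2)) = -(p * ε / 4) := by ring
  rwa [← Real.exp_add, hexp]

end Accuracy

section Linearization

variable {T}

lemma IsTensorTrain.connected [Fintype V] [Nonempty V] (h : T.IsTensorTrain) :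
    T.graph.Connected := by
  obtain ⟨-, f, -⟩ := h
  obtain ⟨n, hn⟩ := Nat.exists_eq_succ_of_ne_zero (Fintype.card_ne_zero (α := V))
  rw [f.connected_iff, hn]
  exact SimpleGraph.pathGraph_connected n

variable [Fintype V] [Fintype O] {m : ℕ}

lemma le_rowSize {τ : V ≃ Fin (Fintype.card V)} {v : V} (ho : ∀ o, m ≤ T.outDim o)
    (hb : ∀ e, m ≤ T.bondDim e)
    (hv : (∃ o, T.outVertex o = v) ∨ ∃ w, T.graph.Adj v w ∧ τ v < τ w) : m ≤ T.rowSize τ v := by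
  classical
  rcases m.eq_zero_or_pos with rfl | hm
  · exact Nat.zero_le _
  have hout (s : Finset O) (o) (h : o ∈ s) : T.outDim o ≤ ∏ o ∈ s, T.outDim o :=
    Finset.single_le_prod' (fun o _ => hm.trans_le (ho o)) h
  have hbond (s : Finset T.graph.edgeSet) (e) (h : e ∈ s) : T.bondDim e ≤ ∏ e ∈ s, T.bondDim e :=
    Finset.single_le_prod' (fun e _ => hm.trans_le (hb e)) h
  rcases hv with ⟨o, hov⟩ | ⟨w, hadj, hlt⟩
  · refine (ho o).trans ((hout _ o (by simpa using hov)).trans (Nat.le_mul_of_pos_right _ ?_))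
    exact Finset.prod_pos fun e _ => hm.trans_le (hb e)
  · have hmem : ∃ u, s(v, w) = s(v, u) ∧ τ v < τ u := ⟨w, rfl, hlt⟩
    refine (hb ⟨s(v, w), hadj⟩).trans ((hbond _ _ (by simpa using hmem)).trans
      (Nat.le_mul_of_pos_left _ ?_))
    exact Finset.prod_pos fun o _ => hm.trans_le (ho o)

lemma exists_forall_le_rowSize [Nonempty O] (hT : T.graph.Connected) (ho : ∀ o, m ≤ T.outDim o)
    (hb : ∀ e, m ≤ T.bondDim e) :
    ∃ τ : V ≃ Fin (Fintype.card V), ∀ v, m ≤ T.rowSize τ v := by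
  obtain ⟨o⟩ := ‹Nonempty O›
  obtain ⟨τ, hτ⟩ := exists_equiv_fin_lt_of_lt fun v => OrderDual.toDual
    (T.graph.dist v (T.outVertex o))
  refine ⟨τ, fun v => le_rowSize ho hb ?_⟩
  rcases eq_or_ne v (T.outVertex o) with rfl | hne
  · exact Or.inl ⟨o, rfl⟩
  · obtain ⟨w, hadj, hlt⟩ := exists_adj_dist_lt (hT v (T.outVertex o)) hne
    exact Or.inr ⟨w, hadj, hτ v w hlt⟩

end Linearization

end TensorNetworkEmbedding

theorem corollary3p1_general (δ₀ : ℝ) (hδ₀ : δ₀ < 1) :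
    ∃ C : ℝ, 0 < C ∧
      ∀ (ε δ : ℝ), 0 < ε → ε ≤ 1 → 0 < δ → δ ≤ δ₀ →
      ∀ (V I O : Type*) [Fintype V] [Fintype I] [DecidableEq I] [Fintype O] [DecidableEq O]
        [Nonempty O] (T : TensorNetworkEmbedding V I O) (m : ℕ),
        T.graph.Connected →
        (∀ o, m ≤ T.outDim o) →
        (∀ e, m ≤ T.bondDim e) →
      ∀ (σ : V ≃ Fin (Fintype.card V))
        (Ω : Type*) [MeasurableSpace Ω] (P : Measure Ω) [IsFiniteMeasure P]
        (Z : (v : V) → T.TensorIndex v → Ω → ℝ), IsIIDStandardNormal P Z →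
        C * (Fintype.card V * Real.log (1 / δ) / ε ^ 2) ≤ m →
        IsAccurateEmbedding P (T.embeddingMatrix σ Z) ε δ := by
  rcases le_or_gt δ₀ 0 with h0 | h0
  · exact ⟨1, one_pos, fun _ _ _ _ hδ hδδ₀ => absurd (hδ.trans_le hδδ₀) h0.not_gt⟩
  have hlog : 0 < Real.log (1 / δ₀) := Real.log_pos ((one_lt_div h0).2 hδ₀)
  refine ⟨80 * (1 + 1 / Real.log (1 / δ₀)), by positivity, ?_⟩
  intro ε δ hε hε1 hδ hδδ₀ V I O _ _ _ _ _ _ T m hT ho hb σ Ω _ P _ Z hZ hm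
  obtain ⟨τ, hτ⟩ := TensorNetworkEmbedding.exists_forall_le_rowSize hT ho hb
  rw [T.embeddingMatrix_eq σ τ Z]
  exact TensorNetworkEmbedding.isAccurateEmbedding_of_le_rowSize hZ hτ hε hε1 hδ hδδ₀ hδ₀ hm

theorem corollary3p1 (δ₀ : ℝ) (hδ₀ : δ₀ < 1) :
    ∃ C : ℝ, 0 < C ∧
      ∀ (ε δ : ℝ), 0 < ε → ε ≤ 1 → 0 < δ → δ ≤ δ₀ →
      ∀ (V I O : Type*) [Fintype V] [Fintype I] [DecidableEq I] [Fintype O] [DecidableEq O]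
        (T : TensorNetworkEmbedding V I O) (m : ℕ),
        Fintype.card O = 1 →
        (∀ o, T.outDim o = m) →
        (∀ e, T.bondDim e = m) →
      ∀ (σ : V ≃ Fin (Fintype.card V))
        (Ω : Type*) [MeasurableSpace Ω] (P : Measure Ω) [IsProbabilityMeasure P]
        (Z : (v : V) → T.TensorIndex v → Ω → ℝ), IsIIDStandardNormal P Z →
        (T.graph.IsTree →
          C * (Fintype.card V * Real.log (1 / δ) / ε ^ 2) ≤ m →
          IsAccurateEmbedding P (T.embeddingMatrix σ Z) ε δ) ∧
        (T.IsTensorTrain →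
          C * (Fintype.card I * Real.log (1 / δ) / ε ^ 2) ≤ m →
          IsAccurateEmbedding P (T.embeddingMatrix σ Z) ε δ) := by
  obtain ⟨C, hC, hacc⟩ := corollary3p1_general δ₀ hδ₀
  refine ⟨C, hC, fun ε δ hε hε1 hδ hδδ₀ V I O _ _ _ _ _ T m hO ho hb σ Ω _ P _ Z hZ => ?_⟩
  have : Nonempty O := Fintype.card_pos_iff.1 (hO ▸ one_pos)
  have hconn (hT : T.graph.Connected) :=
    hacc ε δ hε hε1 hδ hδδ₀ V I O T m hT (fun o => (ho o).ge) (fun e => (hb e).ge) σ Ω P Z hZ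
  refine ⟨fun hT => hconn hT.connected, fun hT hm => ?_⟩
  have : Nonempty V := this.map T.outVertex
  exact hconn hT.connected (Fintype.card_of_bijective hT.1 ▸ hm)
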